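/- Let $P$ be a (finite or infinite) countable commutative principal ideal domain and let $R=P[x]$. Let $S_1\subset R$ be the multiplicative subset of all nonzero elements of $P$, viewed as constant polynomials, and let $S_2\subset R$ be the multiplicative subset of all polynomials of content $1$, i.e. whose coefficients have greatest common divisor $1$ in $P$. For $J\subset\{1,2\}$ let $S_J\subset R$ be the multiplicative subset generated by the $S_j$ with $j\in J$ (so $S_\varnothing=\{1\}$, and $S_{\{1,2\}}=S_1S_2$), and put $\mathbf S^\times=\{S_J\mid J\subset\{1,2\}\}$. An $R$-module $C$ is called $\mathbf S^\times$-weakly cotorsion if $\operatorname{Ext}^1_R(S_J^{-1}R,C)=0$ for all $J\subset\{1,2\}$, and an $R$-module $F$ is called $\mathbf S^\times$-strongly flat if $\operatorname{Ext}^1_R(F,C)=0$ for all $\mathbf S^\times$-weakly cotorsion $R$-modules $C$. Then every flat $R$-module $F$ is $\mathbf S^\times$-strongly flat. Moreover, every flat $R$-module $F$ is a direct summand of a transfinitely iterated extension of $R$-modules isomorphic to $R$, $S_1^{-1}R$, $S_2^{-1}R$ or $(S_1S_2)^{-1}R$; that is, $F$ is isomorphic to a direct summand of an $R$-module $G$ for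 which there are an ordinal $\gamma$ and submodules $G_\alpha\subset G$, $\alpha\le\gamma$, such that $G_0=0$, $G_\gamma=G$, $G_\alpha\subset G_\beta$ for all $\alpha\le\beta\le\gamma$, $G_\beta=\bigcup_{\alpha<\beta}G_\alpha$ for all limit ordinals $\beta\le\gamma$, and for every $\alpha<\gamma$ the quotient $G_{\alpha+1}/G_\alpha$ is isomorphic to one of the four modules $R$, $S_1^{-1}R$, $S_2^{-1}R$, $(S_1S_2)^{-1}R$. -/

import Mathlib

open Polynomial CategoryTheory

universe u

section StronglyFlat

variable {R : Type u} [CommRing R]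

/-- For a collection `S = (S_j)` of multiplicative subsets, the collection `S^×` of the
multiplicative subsets `S_J` generated by the `S_j` with `j ∈ J`, for all sets of indices `J`.
For `J = ∅` this is the trivial multiplicative subset `{1}`. -/
def multClosure {ι : Type} (S : ι → Submonoid R) (J : Set ι) : Submonoid R :=
  ⨆ j ∈ J, S j

/-- `C` is weakly cotorsion for the collection `S` of multiplicative subsets:
`Ext^1_R(S_j^{-1} R, C) = 0` for every `j`. -/
def IsWeaklyCotorsion {ι : Type} (S : ι → Submonoid R)
    (C : Type u) [AddCommGroup C] [Module R C] : Prop :=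
  ∀ j, Subsingleton
    (Abelian.Ext.{u} (ModuleCat.of R (Localization (S j))) (ModuleCat.of R C) 1)

/-- `F` is strongly flat for the collection `S` of multiplicative subsets:
`Ext^1_R(F, C) = 0` for every `R`-module `C` that is weakly cotorsion for `S`. -/
def IsStronglyFlat {ι : Type} (S : ι → Submonoid R)
    (F : Type u) [AddCommGroup F] [Module R F] : Prop :=
  ∀ (C : Type u) [AddCommGroup C] [Module R C], IsWeaklyCotorsion S C →
    Subsingleton (Abelian.Ext.{u} (ModuleCat.of R F) (ModuleCat.of R C) 1)

/-- `G` is a transfinitely iterated extension, in the sense of the inductive limit, of modules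
isomorphic to members of the family `A`: there is an ordinal `γ` and an increasing family of
submodules `N α`, `α ≤ γ`, from `0` to `G`, continuous at limit ordinals, such that every
quotient `N (α + 1) / N α`, `α < γ`, is isomorphic to some `A k`. -/
def IsTransfiniteExtension {κ : Type} (A : κ → ModuleCat.{u} R)
    (G : Type u) [AddCommGroup G] [Module R G] : Prop :=
  ∃ (γ : Ordinal.{u}) (N : Ordinal.{u} → Submodule R G),
    N 0 = ⊥ ∧ N γ = ⊤ ∧
    (∀ α β, α ≤ β → β ≤ γ → N α ≤ N β) ∧
    (∀ β, β ≤ γ → Order.IsSuccLimit β → (N β : Set G) = ⋃ α ∈ Set.Iio β, (N α : Set G)) ∧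
    (∀ α, α < γ → ∃ k,
      Nonempty ((↥(N (Order.succ α)) ⧸ (N α).submoduleOf (N (Order.succ α))) ≃ₗ[R] A k))

/-- `F` is (isomorphic to) a direct summand of a transfinitely iterated extension of modules
isomorphic to members of the family `A`. -/
def IsSummandOfTransfiniteExtension {κ : Type} (A : κ → ModuleCat.{u} R)
    (F : Type u) [AddCommGroup F] [Module R F] : Prop :=
  ∃ (G : Type u) (_ : AddCommGroup G) (_ : Module R G)
    (F' : Type u) (_ : AddCommGroup F') (_ : Module R F'),
    IsTransfiniteExtension A G ∧ Nonempty (G ≃ₗ[R] (F × F'))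

end StronglyFlat

section Polynomials

variable (P : Type u) [CommRing P] [IsDomain P]

/-- The multiplicative subset of `P[X]` of all nonzero constants. -/
def nonzeroConstants : Submonoid P[X] where
  carrier := {f | ∃ a : P, a ≠ 0 ∧ f = C a}
  one_mem' := ⟨1, one_ne_zero, C_1.symm⟩
  mul_mem' := by
    rintro _ _ ⟨a, ha, rfl⟩ ⟨b, hb, rfl⟩
    exact ⟨a * b, mul_ne_zero ha hb, C_mul.symm⟩

/-- The polynomials of content `1`: the greatest common divisor of the coefficients, which is
defined up to a unit, is `1`; that is, every common divisor of the coefficients is a unit. -/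
def HasContentOne {P : Type u} [CommRing P] (f : P[X]) : Prop :=
  ∀ d : P, (∀ n, d ∣ f.coeff n) → IsUnit d

theorem hasContentOne_iff_isPrimitive {P : Type u} [CommRing P] (f : P[X]) :
    HasContentOne f ↔ f.IsPrimitive := by
  simp only [HasContentOne, IsPrimitive, C_dvd_iff_dvd_coeff]

/-- The multiplicative subset of `P[X]` of all polynomials of content `1`. -/
def contentOne [IsPrincipalIdealRing P] : Submonoid P[X] where
  carrier := {f | HasContentOne f}
  one_mem' := (hasContentOne_iff_isPrimitive _).2 isPrimitive_one
  mul_mem' := by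
    intro f g hf hg
    let _ : StrongNormalizationMonoid P := UniqueFactorizationMonoid.strongNormalizationMonoid
    let _ : NormalizedGCDMonoid P := UniqueFactorizationMonoid.toNormalizedGCDMonoid P
    exact (hasContentOne_iff_isPrimitive _).2
      (((hasContentOne_iff_isPrimitive f).1 hf).mul ((hasContentOne_iff_isPrimitive g).1 hg))

end Polynomials

/-! Write `A₁`, `A₂` for the localizations of `R = P[x]` at the nonzero constants and at the
polynomials of content one, and `Q` for the fraction field. Both `A₁` and `A₂` are principal ideal
domains: the first is `K[x]` with `K = Frac P`, and in the second every ideal comes from `P`. By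
Gauss's lemma `R = A₁ ∩ A₂` inside `Q`, so `0 → R → A₁ × A₂ → Q` is exact. It stays exact after
tensoring with a flat `F`, and embeds `F` in `(A₁ ⊗ F) × (A₂ ⊗ F)` with cokernel a submodule `E` of
`Q ⊗ F`.

Countability makes `Q` a sequential direct limit of copies of `R`, so `Q ⊗ F`, a sum of copies of
`Q`, has projective dimension at most one. As `R` has global dimension at most two, `E` also has
projective dimension at most one (`HasProjectiveDimensionLT _ n` means dimension below `n`). Pulling
back along a free presentation of `E` makes `F`, plus a free module, an extension of `(A₁ ⊗ F) × (A₂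
⊗ F)` by a free module. The same device over `Aᵢ` makes `Aᵢ ⊗ F`, plus a free `Aᵢ`-module, an
extension of a `Q`-vector space by a free `Aᵢ`-module.

Hence `F` is a summand of a finitely iterated extension of direct sums of the four localizations
(`Module.Flat.exists_prod_of_isPrincipalIdealRing`, `Polynomial.exists_prod_of_flat`). This is
stated for any property `Φ` that is closed under extensions and holds for such direct sums; both
claims are instances. -/

section HomologicalAlgebra

/-! ### Homological dimension, free presentations and pullbacks -/

variable {A : Type u} [CommRing A]

/-- A divisible module over a principal ideal domain is injective. -/
theorem Module.Injective.of_divisible_of_isPrincipalIdealRing [IsPrincipalIdealRing A]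
    {M : Type u} [AddCommGroup M] [Module A M]
    (h : ∀ a : A, a ≠ 0 → ∀ m : M, ∃ n : M, a • n = m) : Module.Injective A M := by
  refine Module.Baer.injective fun I g ↦ ?_
  rcases IsPrincipalIdealRing.principal I with ⟨m, rfl⟩
  obtain rfl | h0 := eq_or_ne m 0
  · refine ⟨0, fun n hn ↦ ?_⟩
    rw [Submodule.span_zero_singleton] at hn
    subst hn
    exact (map_zero g).symm
  obtain ⟨z, hz⟩ := h m h0 (g ⟨m, Submodule.subset_span (Set.mem_singleton _)⟩)
  refine ⟨LinearMap.toSpanSingleton A M z, fun n hn ↦ ?_⟩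
  rcases Submodule.mem_span_singleton.mp hn with ⟨n, rfl⟩
  rw [LinearMap.toSpanSingleton_apply]
  simp only [smul_eq_mul, mul_smul]
  rw [hz, ← map_smul g, SetLike.mk_smul_mk]
  rfl

theorem Module.Injective.exists_smul_eq [IsDomain A] {M : Type u} [AddCommGroup M] [Module A M]
    [Module.Injective A M] (a : A) (ha : a ≠ 0) (m : M) : ∃ n : M, a • n = m := by
  obtain ⟨g, hg⟩ := Module.Injective.out (R := A) (Q := M) (LinearMap.lsmul A A a)
    (fun x y hxy ↦ mul_left_cancel₀ ha hxy) (LinearMap.toSpanSingleton A M m)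
  refine ⟨g 1, ?_⟩
  have := hg 1
  rw [← map_smul]
  simpa using this

/-- Quotients of divisible modules are divisible, so the cokernel of an embedding into an injective
module is again injective. Every module thus has injective dimension at most one, and `Ext²`
vanishes. -/
theorem hasProjectiveDimensionLT_two_of_isPrincipalIdealRing [IsDomain A] [IsPrincipalIdealRing A]
    (M : ModuleCat.{u} A) : HasProjectiveDimensionLT M 2 := by
  refine hasProjectiveDimensionLT_of_enoughInjectives M 2 fun Y ↦ ?_
  obtain ⟨p⟩ := EnoughInjectives.presentation Y
  have hS : (ShortComplex.mk _ _ (Limits.cokernel.condition p.f)).ShortExact :=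
    { exact := ShortComplex.exact_cokernel p.f }
  have hJ' : Injective (ModuleCat.of A p.J) := p.injective
  have hJ : Module.Injective A p.J := Module.injective_module_of_injective_object A p.J
  have hC : Module.Injective A (Limits.cokernel p.f : ModuleCat.{u} A) := by
    refine Module.Injective.of_divisible_of_isPrincipalIdealRing fun a ha m ↦ ?_
    obtain ⟨m, rfl⟩ := (ModuleCat.epi_iff_surjective (Limits.cokernel.π p.f)).1 inferInstance m
    obtain ⟨n, rfl⟩ := Module.Injective.exists_smul_eq (M := p.J) a ha m
    exact ⟨_, (map_smul (Limits.cokernel.π p.f).hom a n).symm⟩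
  have : Injective (Limits.cokernel p.f : ModuleCat.{u} A) :=
    Module.injective_object_of_injective_module (inj := hC)
  have : HasInjectiveDimensionLT Y 2 :=
    hS.hasInjectiveDimensionLT_X₁ 1 inferInstance inferInstance
  exact HasInjectiveDimensionLT.subsingleton Y 2 2 le_rfl M

theorem ModuleCat.shortExact_mk_of_exact {K L M : Type u} [AddCommGroup K] [Module A K]
    [AddCommGroup L] [Module A L] [AddCommGroup M] [Module A M] {i : K →ₗ[A] L} {p : L →ₗ[A] M}
    (hi : Function.Injective i) (h : Function.Exact i p) (hp : Function.Surjective p) :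
    (ShortComplex.mk (ModuleCat.ofHom i) (ModuleCat.ofHom p)
      (by ext x; exact h.apply_apply_eq_zero x)).ShortExact where
  exact := (ShortComplex.ShortExact.moduleCat_exact_iff_function_exact _).2 h
  mono_f := (ModuleCat.mono_iff_injective _).2 hi
  epi_g := (ModuleCat.epi_iff_surjective _).2 hp

/-- Eilenberg's swindle. -/
theorem Module.Projective.exists_prod_finsupp_equiv (K : Type u) [AddCommGroup K] [Module A K]
    [Module.Projective A K] : ∃ X : Type u, Nonempty ((K × (X →₀ A)) ≃ₗ[A] (X →₀ A)) := by
  obtain ⟨s, hs⟩ := Module.projective_def'.1 ‹Module.Projective A K›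
  let p := Finsupp.linearCombination A (id : K → K)
  have hps (x : K) : p (s x) = x := LinearMap.congr_fun hs x
  let N := LinearMap.ker p
  let e₀ : (K →₀ A) ≃ₗ[A] (K × N) :=
    LinearEquiv.ofLinearMap
      (LinearMap.prod p (LinearMap.codRestrict N (LinearMap.id - s ∘ₗ p)
        fun x ↦ by simp [N, hps]))
      (LinearMap.coprod s N.subtype)
      (by
        refine LinearMap.ext fun ⟨x, y⟩ ↦ Prod.ext ?_ (Subtype.ext ?_)
        · simp [hps, LinearMap.mem_ker.1 y.2]
        · simp [hps, LinearMap.mem_ker.1 y.2])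
      (by
        refine LinearMap.ext fun x ↦ ?_
        simp)
  let e₁ : (ℕ × K →₀ A) ≃ₗ[A] ((ℕ →₀ K) × (ℕ →₀ N)) :=
    (Finsupp.curryLinearEquiv A ≪≫ₗ Finsupp.mapRange.linearEquiv e₀) ≪≫ₗ
      LinearEquiv.ofLinearMap
        (LinearMap.prod (Finsupp.mapRange.linearMap (LinearMap.fst A K N))
          (Finsupp.mapRange.linearMap (LinearMap.snd A K N)))
        (LinearMap.coprod (Finsupp.mapRange.linearMap (LinearMap.inl A K N))
          (Finsupp.mapRange.linearMap (LinearMap.inr A K N)))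
        (by ext <;> simp) (by ext <;> simp)
  -- One more copy of `K` is absorbed by shifting the index. Since `K × N` is free, countably many
  -- copies of `K` and of `N` together are free.
  let e₂ : (K × (ℕ →₀ K)) ≃ₗ[A] (ℕ →₀ K) :=
    (LinearEquiv.prodCongr (Finsupp.uniqueLinearEquiv A K ()).symm
      (LinearEquiv.refl A (ℕ →₀ K))) ≪≫ₗ (Finsupp.sumFinsuppLEquivProdFinsupp A).symm ≪≫ₗ
      Finsupp.domLCongr (Equiv.natSumPUnitEquivNat.symm.trans (Equiv.sumComm _ _)).symm
  refine ⟨ℕ × K, ⟨(LinearEquiv.prodCongr (LinearEquiv.refl A K) e₁) ≪≫ₗ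
    (LinearEquiv.prodAssoc A K (ℕ →₀ K) (ℕ →₀ N)).symm ≪≫ₗ
    LinearEquiv.prodCongr e₂ (LinearEquiv.refl A (ℕ →₀ N)) ≪≫ₗ e₁.symm⟩⟩

/-- The kernel of a free cover is projective; adding a suitable free module to both kernel and cover
makes the kernel free, by the swindle. -/
theorem exists_free_presentation (T : Type u) [AddCommGroup T] [Module A T]
    (h : HasProjectiveDimensionLT (ModuleCat.of A T) 2) :
    ∃ (Z B : Type u) (i : (Z →₀ A) →ₗ[A] (B →₀ A)) (p : (B →₀ A) →ₗ[A] T),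
      Function.Injective i ∧ Function.Exact i p ∧ Function.Surjective p := by
  let p := Finsupp.linearCombination A (id : T → T)
  have hp : Function.Surjective p := Finsupp.linearCombination_id_surjective A T
  have hex : Function.Exact (LinearMap.ker p).subtype p := LinearMap.exact_subtype_ker_map p
  have hS := ModuleCat.shortExact_mk_of_exact (K := LinearMap.ker p) (L := T →₀ A) (M := T)
    (LinearMap.ker p).injective_subtype hex hp
  have : HasProjectiveDimensionLT (ModuleCat.of A (LinearMap.ker p)) 1 :=
    hS.hasProjectiveDimensionLT_X₁ 1 inferInstance h
  have : Module.Projective A (LinearMap.ker p) :=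
    (IsProjective.iff_projective (R := A) (LinearMap.ker p)).2 inferInstance
  obtain ⟨X, ⟨e⟩⟩ := Module.Projective.exists_prod_finsupp_equiv (A := A) (LinearMap.ker p)
  let e' : ((T →₀ A) × (X →₀ A)) ≃ₗ[A] (T ⊕ X →₀ A) := (Finsupp.sumFinsuppLEquivProdFinsupp A).symm
  refine ⟨X, T ⊕ X, e'.toLinearMap ∘ₗ (LinearMap.prodMap (LinearMap.ker p).subtype LinearMap.id) ∘ₗ
    e.symm.toLinearMap, p ∘ₗ LinearMap.fst _ _ _ ∘ₗ e'.symm.toLinearMap, ?_, ?_, ?_⟩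
  · exact e'.injective.comp (((LinearMap.ker p).injective_subtype.prodMap
      Function.injective_id).comp e.symm.injective)
  · intro x
    constructor
    · intro hx
      refine ⟨e (⟨(e'.symm x).1, hx⟩, (e'.symm x).2), ?_⟩
      simp
    · rintro ⟨y, rfl⟩
      simp
  · exact hp.comp (Prod.fst_surjective.comp e'.symm.surjective)

/-- If `L` is projective, the pullback `W` of `V → T ← L` is isomorphic to `M × L`. -/
theorem exists_pullback_equiv_prod {M V T Z L : Type u}
    [AddCommGroup M] [Module A M] [AddCommGroup V] [Module A V] [AddCommGroup T] [Module A T]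
    [AddCommGroup Z] [Module A Z] [AddCommGroup L] [Module A L] [Module.Projective A L]
    (j : M →ₗ[A] V) (q : V →ₗ[A] T) (hj : Function.Injective j) (hjq : Function.Exact j q)
    (hq : Function.Surjective q)
    (i : Z →ₗ[A] L) (p : L →ₗ[A] T) (hi : Function.Injective i) (hip : Function.Exact i p)
    (hp : Function.Surjective p) :
    ∃ (k : Z →ₗ[A] M × L) (π : M × L →ₗ[A] V),
      Function.Injective k ∧ Function.Exact k π ∧ Function.Surjective π := by
  obtain ⟨s, hs⟩ := Module.projective_lifting_property q p hq
  -- `π (m, l) = j m + s l`, and its kernel is identified with that of `p`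
  have hs' (l : L) : q (s l) = p l := LinearMap.congr_fun hs l
  have hmem (z : Z) : s (i z) ∈ LinearMap.range j := by
    have := (hjq (s (i z))).1 (by rw [hs', hip.apply_apply_eq_zero])
    exact this
  -- On `Z` the lift `s ∘ i` lands in `ker q = range j`, so it factors through `j` as `c`. The pairs
  -- `(-c z, i z)` then form the kernel of `π`.
  let c : Z →ₗ[A] M := (LinearEquiv.ofInjective j hj).symm.toLinearMap ∘ₗ
    LinearMap.codRestrict (LinearMap.range j) (s ∘ₗ i) hmem
  have hc (z : Z) : j (c z) = s (i z) := by
    have := congrArg Subtype.val ((LinearEquiv.ofInjective j hj).apply_symm_apply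
      (LinearMap.codRestrict (LinearMap.range j) (s ∘ₗ i) hmem z))
    exact this
  refine ⟨LinearMap.prod (-c) i, LinearMap.coprod j s, ?_, ?_, ?_⟩
  · intro x y hxy
    exact hi (congrArg Prod.snd hxy)
  · rintro ⟨m, l⟩
    constructor
    · intro h
      replace h : j m + s l = 0 := h
      have : p l = 0 := by
        simpa [hjq.apply_apply_eq_zero, hs'] using congrArg q h
      obtain ⟨z, rfl⟩ := (hip l).1 this
      refine ⟨z, Prod.ext (hj ?_) rfl⟩
      simpa [hc] using (eq_neg_of_add_eq_zero_left h).symm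
    · rintro ⟨z, hz⟩
      rw [← hz]
      simp [hc]
  · intro v
    obtain ⟨l, hl⟩ := hp (q v)
    obtain ⟨m, hm⟩ := (hjq (v - s l)).1 (by rw [map_sub, hs', hl, sub_self])
    exact ⟨(m, l), by simp [hm]⟩

end HomologicalAlgebra

/-! ### Projective dimension of the fraction field and of `P[x]`-modules -/

section ProjectiveDimension

open TensorProduct

/-- Over a countable domain, the field of fractions is the direct limit of a sequence of free
modules of rank one, and therefore has a free resolution of length one. -/
theorem IsFractionRing.exists_free_resolution (R Q : Type*) [CommRing R] [IsDomain R] [Countable R]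
    [CommRing Q] [Algebra R Q] [IsFractionRing R Q] :
    ∃ (φ : (ℕ →₀ R) →ₗ[R] (ℕ →₀ R)) (p : (ℕ →₀ R) →ₗ[R] Q),
      Function.Injective φ ∧ Function.Exact φ p ∧ Function.Surjective p := by
  have : Nonempty (nonZeroDivisors R) := ⟨1⟩
  obtain ⟨s, hs⟩ := exists_surjective_nat (nonZeroDivisors R)
  -- Enumerate all denominators and multiply the first `n`. The fractions `q n = 1 / π n` satisfy `q
  -- n = s n • q (n + 1)`, the relations encoded by `φ`, and every denominator divides some `π (n +
  -- 1)`.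
  let π : ℕ → nonZeroDivisors R := fun n ↦ ∏ i ∈ Finset.range n, s i
  have hπ (n : ℕ) : π (n + 1) = π n * s n := Finset.prod_range_succ _ _
  let q : ℕ → Q := fun n ↦ IsLocalization.mk' Q 1 (π n)
  have hq (n : ℕ) : (s n : R) • q (n + 1) = q n := by
    rw [IsLocalization.smul_mk', mul_one, IsLocalization.mk'_eq_iff_eq, hπ]
    simp [mul_comm]
  let φ : (ℕ →₀ R) →ₗ[R] (ℕ →₀ R) :=
    Finsupp.linearCombination R fun n ↦ Finsupp.single n 1 - Finsupp.single (n + 1) (s n : R)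
  let p := Finsupp.linearCombination R q
  have hφ (n : ℕ) (r : R) : φ (Finsupp.single n r) =
      Finsupp.single n r - Finsupp.single (n + 1) (r * s n) := by
    simp [φ, smul_sub]
  have hφ0 (f : ℕ →₀ R) : φ f 0 = f 0 := by
    induction f using Finsupp.induction_linear with
    | zero => simp
    | add f g hf hg => simp [hf, hg]
    | single n r => simp [hφ]
  have hφs (f : ℕ →₀ R) (n : ℕ) : φ f (n + 1) = f (n + 1) - f n * s n := by
    induction f using Finsupp.induction_linear with
    | zero => simp
    | add f g hf hg => simp only [map_add, Finsupp.add_apply, hf, hg]; ring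
    | single m r =>
      rw [hφ]
      by_cases h : m = n
      · subst h; simp
      · simp [Finsupp.single_apply, h]
  have hpφ (f : ℕ →₀ R) : p (φ f) = 0 := by
    induction f using Finsupp.induction_linear with
    | zero => simp
    | add f g hf hg => simp [hf, hg]
    | single n r =>
      rw [hφ, map_sub, Finsupp.linearCombination_single, Finsupp.linearCombination_single,
        mul_smul, hq, sub_self]
  refine ⟨φ, p, ?_, ?_, ?_⟩
  · rw [injective_iff_map_eq_zero]
    intro f hf
    ext n
    induction n with
    | zero => rw [← hφ0, hf]
    | succ n ih =>
      have := hφs f n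
      rw [hf, ih] at this
      simpa using this.symm
  -- Modulo the range of `φ`, every vector can be pushed to a multiple of a single basis vector of
  -- large index; its coefficient vanishes if its image in `Q` does.
  · have hstep (n k : ℕ) (r : R) : ∃ c : R,
        Finsupp.single n r - Finsupp.single (n + k) c ∈ LinearMap.range φ := by
      induction k with
      | zero => exact ⟨r, by simp⟩
      | succ k ih =>
        obtain ⟨c, hc⟩ := ih
        refine ⟨c * s (n + k), ?_⟩
        have := add_mem hc (LinearMap.mem_range_self φ (Finsupp.single (n + k) c))
        rw [hφ] at this
        simpa [add_assoc] using this
    have hbound (f : ℕ →₀ R) : ∃ N, ∀ m ≥ N, ∃ c : R,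
        f - Finsupp.single m c ∈ LinearMap.range φ := by
      induction f using Finsupp.induction_linear with
      | zero => exact ⟨0, fun m _ ↦ ⟨0, by simp⟩⟩
      | add f g hf hg =>
        obtain ⟨N₁, h₁⟩ := hf
        obtain ⟨N₂, h₂⟩ := hg
        refine ⟨max N₁ N₂, fun m hm ↦ ?_⟩
        obtain ⟨c, hc⟩ := h₁ m (le_trans (le_max_left _ _) hm)
        obtain ⟨d, hd⟩ := h₂ m (le_trans (le_max_right _ _) hm)
        refine ⟨c + d, ?_⟩
        rw [Finsupp.single_add, add_sub_add_comm]
        exact add_mem hc hd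
      | single n r =>
        refine ⟨n, fun m hm ↦ ?_⟩
        obtain ⟨k, rfl⟩ := Nat.exists_eq_add_of_le hm
        exact hstep n k r
    intro f
    refine ⟨fun hf ↦ ?_, by rintro ⟨g, rfl⟩; exact hpφ g⟩
    obtain ⟨N, hN⟩ := hbound f
    obtain ⟨c, g, hg⟩ := hN N le_rfl
    have h0 := congrArg p hg
    rw [hpφ, map_sub, hf, zero_sub, eq_comm, neg_eq_zero] at h0
    have hc : c = 0 := by
      rw [Finsupp.linearCombination_single, IsLocalization.smul_mk', mul_one,
        IsLocalization.mk'_eq_zero_iff] at h0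
      obtain ⟨m, hm⟩ := h0
      exact (mul_eq_zero.1 hm).resolve_left (nonZeroDivisors.coe_ne_zero m)
    exact ⟨g, by simpa [hc] using hg⟩
  · intro x
    obtain ⟨r, t, rfl⟩ := IsLocalization.exists_mk'_eq (nonZeroDivisors R) x
    obtain ⟨n, rfl⟩ := hs t
    -- Here `r / s n = r * π n / π (n + 1)`.
    refine ⟨Finsupp.single (n + 1) (r * π n), ?_⟩
    rw [Finsupp.linearCombination_single, IsLocalization.smul_mk', mul_one,
      IsLocalization.mk'_eq_iff_eq, hπ]
    push_cast
    ring_nf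

theorem Finsupp.mapRange_exact {R K L M : Type*} [CommRing R] [AddCommGroup K] [Module R K]
    [AddCommGroup L] [Module R L] [AddCommGroup M] [Module R M] {i : K →ₗ[R] L} {p : L →ₗ[R] M}
    (hi : Function.Injective i) (hip : Function.Exact i p) (Y : Type*) :
    Function.Exact (Finsupp.mapRange.linearMap (α := Y) i)
      (Finsupp.mapRange.linearMap (α := Y) p) := by
  rw [LinearMap.exact_iff] at hip ⊢
  rw [Finsupp.ker_mapRange, hip, Finsupp.range_mapRange_linearMap i (LinearMap.ker_eq_bot.2 hi)]

theorem Finsupp.hasProjectiveDimensionLT_two_of_exact {R Q : Type u} [CommRing R]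
    [AddCommGroup Q] [Module R Q] {ι κ : Type} (Y : Type u)
    (φ : (ι →₀ R) →ₗ[R] (κ →₀ R)) (p : (κ →₀ R) →ₗ[R] Q)
    (hφ : Function.Injective φ) (hφp : Function.Exact φ p) (hp : Function.Surjective p) :
    HasProjectiveDimensionLT (ModuleCat.of R (Y →₀ Q)) 2 := by
  have hS := ModuleCat.shortExact_mk_of_exact (K := Y →₀ (ι →₀ R)) (L := Y →₀ (κ →₀ R))
    (M := Y →₀ Q) (Finsupp.mapRange_injective _ (map_zero _) hφ)
    (Finsupp.mapRange_exact hφ hφp Y)    (Finsupp.mapRange_surjective _ (map_zero _) hp)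
  exact hS.hasProjectiveDimensionLT_X₃ 1 inferInstance inferInstance

/-- The presentation `P[X] ⊗ N → P[X] ⊗ N → N` of a `P[X]`-module by extended modules. -/
theorem Polynomial.exists_extended_presentation (P N : Type u) [CommRing P] [AddCommGroup N]
    [Module P N] [Module P[X] N] [IsScalarTower P P[X] N] :
    ∃ (φ : P[X] ⊗[P] N →ₗ[P[X]] P[X] ⊗[P] N) (p : P[X] ⊗[P] N →ₗ[P[X]] N),
      Function.Injective φ ∧ Function.Exact φ p ∧ Function.Surjective p := by
  let x : N →ₗ[P] N := (LinearMap.lsmul P[X] N X).restrictScalars P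
  let φ : P[X] ⊗[P] N →ₗ[P[X]] P[X] ⊗[P] N :=
    LinearMap.lsmul P[X] (P[X] ⊗[P] N) X - x.baseChange P[X]
  let p : P[X] ⊗[P] N →ₗ[P[X]] N := (LinearMap.id : N →ₗ[P] N).liftBaseChange P[X]
  have hφ (f : P[X]) (n : N) : φ (f ⊗ₜ n) = (X * f) ⊗ₜ n - f ⊗ₜ ((X : P[X]) • n) := by
    simp [φ, x, TensorProduct.smul_tmul']
  have hp (f : P[X]) (n : N) : p (f ⊗ₜ n) = f • n := by simp [p]
  have hpφ (z : P[X] ⊗[P] N) : p (φ z) = 0 := by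
    induction z with
    | zero => simp
    | add a b ha hb => simp [ha, hb]
    | tmul f n => rw [hφ, map_sub, hp, hp, mul_comm, mul_smul, sub_self]
  refine ⟨φ, p, ?_, ?_, fun n ↦ ⟨1 ⊗ₜ n, by simp [hp]⟩⟩
  -- Expand `z = ∑ xⁱ ⊗ zᵢ`. If `φ z = 0`, then `zᵢ = x • zᵢ₊₁` for all `i`, hence `zᵢ = xᵏ • zᵢ₊ₖ`,
  -- which is zero for large `k`.
  · let e := TensorProduct.equivFinsuppOfBasisLeft (N := N) (Polynomial.basisMonomials P)
    have he (f : P[X]) (n : N) (i : ℕ) : e (f ⊗ₜ n) i = f.coeff i • n :=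
      TensorProduct.equivFinsuppOfBasisLeft_apply_tmul_apply _ f n i
    have heφ (z : P[X] ⊗[P] N) (i : ℕ) : e (φ z) (i + 1) = e z i - (X : P[X]) • e z (i + 1) := by
      induction z with
      | zero => simp
      | add a b ha hb => simp only [map_add, Finsupp.add_apply, ha, hb, smul_add]; abel
      | tmul f n =>
        rw [hφ, map_sub, Finsupp.sub_apply, he, he, he, he, coeff_X_mul,
          smul_comm (X : P[X]) (f.coeff (i + 1)) n]
    rw [injective_iff_map_eq_zero]
    intro z hz
    have hrec (i : ℕ) : e z i = (X : P[X]) • e z (i + 1) := by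
      have := heφ z i
      rw [hz, map_zero, Finsupp.zero_apply] at this
      exact (sub_eq_zero.1 this.symm)
    have hpow (i k : ℕ) : e z i = (X ^ k : P[X]) • e z (i + k) := by
      induction k with
      | zero => simp
      | succ k ih => rw [ih, hrec, ← mul_smul, pow_succ, add_assoc]
    rw [← map_eq_zero_iff e e.injective]
    ext i
    obtain ⟨m, hm⟩ := (e z).support.exists_nat_subset_range
    rw [hpow i m, Finsupp.notMem_support_iff.1 (fun h ↦ by simpa using hm h), smul_zero]
    rfl
  -- Modulo the range of `φ`, powers of `x` move across the tensor sign, so `z` is congruent to `1 ⊗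
  -- p z`.
  · have hmem (z : P[X] ⊗[P] N) : z - 1 ⊗ₜ p z ∈ LinearMap.range φ := by
      have hX (k : ℕ) (n : N) : (X ^ k : P[X]) ⊗ₜ[P] n - 1 ⊗ₜ[P] ((X ^ k : P[X]) • n) ∈
          LinearMap.range φ := by
        induction k generalizing n with
        | zero => simp
        | succ k ih =>
          have := add_mem (LinearMap.mem_range_self φ ((X ^ k : P[X]) ⊗ₜ[P] n))
            (ih ((X : P[X]) • n))
          rwa [hφ, sub_add_sub_cancel, ← pow_succ', ← mul_smul, ← pow_succ] at this
      induction z with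
      | zero => simp
      | add a b ha hb =>
        rw [map_add, tmul_add, add_sub_add_comm]
        exact add_mem ha hb
      | tmul f n =>
        rw [hp]
        induction f using Polynomial.induction_on' with
        | add f g hf hg =>
          rw [add_smul, tmul_add, add_tmul, add_sub_add_comm]
          exact add_mem hf hg
        | monomial k a =>
          have := hX k (a • n)
          rwa [← smul_tmul, smul_comm, ← smul_assoc, smul_X_eq_monomial] at this
    intro z
    refine ⟨fun hz ↦ ?_, by rintro ⟨g, rfl⟩; exact hpφ g⟩
    have := hmem z
    rwa [hz, tmul_zero, sub_zero] at this

/-- A free presentation over `P` of length one base-changes to one of `P[x] ⊗ N`, because `P[x]` is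
flat over `P`. The presentation of `N` by extended modules raises the dimension by at most one. -/
theorem Polynomial.hasProjectiveDimensionLT_three (P : Type u) [CommRing P] [IsDomain P]
    [IsPrincipalIdealRing P] (N : Type u) [AddCommGroup N] [Module P[X] N] :
    HasProjectiveDimensionLT (ModuleCat.of P[X] N) 3 := by
  let _ : Module P N := Module.compHom N (C : P →+* P[X])
  have : IsScalarTower P P[X] N := IsScalarTower.of_algebraMap_smul fun r x ↦ rfl
  obtain ⟨φ, p, hφ, hφp, hp⟩ := Polynomial.exists_extended_presentation P N
  have hE : HasProjectiveDimensionLT (ModuleCat.of P[X] (P[X] ⊗[P] N)) 2 := by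
    obtain ⟨Z, B, i, q, hi, hiq, hq⟩ := exists_free_presentation (A := P) N
      (hasProjectiveDimensionLT_two_of_isPrincipalIdealRing _)
    have hS := ModuleCat.shortExact_mk_of_exact (i := i.baseChange P[X]) (p := q.baseChange P[X])
      (Module.Flat.lTensor_preserves_injective_linearMap i hi)
      (lTensor_exact P[X] hiq hq) (LinearMap.lTensor_surjective P[X] hq)
    exact hS.hasProjectiveDimensionLT_X₃ 1 inferInstance inferInstance
  have hS := ModuleCat.shortExact_mk_of_exact hφ hφp hp
  exact hS.hasProjectiveDimensionLT_X₃ 2 hE (hasProjectiveDimensionLT_of_ge _ 2 3 (by lia))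

end ProjectiveDimension

/-! ### Transfinite filtrations -/

section Filtrations

variable {R : Type u} [CommRing R]

/-- Surjections with prescribed kernel are easier than quotients to transport along images and
preimages of submodules. -/
theorem Submodule.nonempty_quotient_submoduleOf_equiv_iff {G M : Type*} [AddCommGroup G] [Module R G]
    [AddCommGroup M] [Module R M] (A B : Submodule R G) :
    Nonempty ((↥B ⧸ A.submoduleOf B) ≃ₗ[R] M) ↔
      ∃ f : B →ₗ[R] M, Function.Surjective f ∧ ∀ x : B, f x = 0 ↔ (x : G) ∈ A := by
  constructor
  · rintro ⟨e⟩
    refine ⟨e.toLinearMap ∘ₗ (A.submoduleOf B).mkQ,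
      e.surjective.comp (Submodule.mkQ_surjective _), fun x ↦ ?_⟩
    rw [LinearMap.comp_apply, LinearEquiv.coe_coe, map_eq_zero_iff e e.injective,
      Submodule.mkQ_apply, Submodule.Quotient.mk_eq_zero]
    rfl
  · rintro ⟨f, hf, hA⟩
    have h : A.submoduleOf B = LinearMap.ker f := by
      ext x
      exact (hA x).symm
    exact ⟨(Submodule.quotEquivOfEq _ _ h).trans (f.quotKerEquivOfSurjective hf)⟩

/-- The filtrations are concatenated along `γ' + γ''`: images under `i` up to `γ'`, then preimages
under `p`. -/
theorem IsTransfiniteExtension.of_exact {κ : Type} {A : κ → ModuleCat.{u} R}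
    {G' G G'' : Type u} [AddCommGroup G'] [Module R G'] [AddCommGroup G] [Module R G]
    [AddCommGroup G''] [Module R G''] (i : G' →ₗ[R] G) (p : G →ₗ[R] G'')
    (hi : Function.Injective i) (hip : Function.Exact i p) (hp : Function.Surjective p)
    (h' : IsTransfiniteExtension A G') (h'' : IsTransfiniteExtension A G'') :
    IsTransfiniteExtension A G := by
  obtain ⟨γ', N', h0', h1', hm', hl', hs'⟩ := h'
  obtain ⟨γ'', N'', h0'', h1'', hm'', hl'', hs''⟩ := h''
  let N : Ordinal.{u} → Submodule R G := fun α ↦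
    if α < γ' then (N' α).map i else (N'' (α - γ')).comap p
  have hN2 (δ : Ordinal.{u}) : N (γ' + δ) = (N'' δ).comap p := by
    simp [N]
  -- The two descriptions agree at `γ'`, since `range i = ker p`.
  have hN1 (α : Ordinal.{u}) (h : α ≤ γ') : N α = (N' α).map i := by
    rcases h.lt_or_eq with h | rfl
    · simp [N, h]
    · have := hN2 0
      rw [add_zero] at this
      rw [this, h0'', h1', Submodule.map_top, Submodule.comap_bot]
      exact hip.linearMap_ker_eq
  have hsucc (δ : Ordinal.{u}) : Order.succ (γ' + δ) = γ' + Order.succ δ := by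
    rw [Order.succ_eq_add_one, Order.succ_eq_add_one, add_assoc]
  refine ⟨γ' + γ'', N, ?_, ?_, ?_, ?_, ?_⟩
  · rw [hN1 0 (zero_le), h0', Submodule.map_bot]
  · rw [hN2, h1'', Submodule.comap_top]
  · intro α β hαβ hβ
    rcases le_total β γ' with hβ' | hβ'
    · rw [hN1 α (hαβ.trans hβ'), hN1 β hβ']
      exact Submodule.map_mono (hm' α β hαβ hβ')
    · obtain ⟨ε, rfl⟩ := exists_add_of_le hβ'
      have hε : ε ≤ γ'' := (add_le_add_iff_left γ').1 hβ
      rcases le_total α γ' with hα' | hα'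
      · rw [hN1 α hα', hN2]
        rintro _ ⟨x, -, rfl⟩
        simp [hip.apply_apply_eq_zero]
      · obtain ⟨δ, rfl⟩ := exists_add_of_le hα'
        rw [hN2, hN2]
        exact Submodule.comap_mono (hm'' δ ε ((add_le_add_iff_left γ').1 hαβ) hε)
  · intro β hβ hlim
    rcases le_or_gt β γ' with hβ' | hβ'
    · rw [hN1 β hβ', Submodule.map_coe, hl' β hβ' hlim, Set.image_iUnion₂]
      refine Set.iUnion₂_congr fun α hα ↦ ?_
      rw [hN1 α ((Set.mem_Iio.1 hα).le.trans hβ'), Submodule.map_coe]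
    · obtain ⟨ε, rfl⟩ := exists_add_of_le hβ'.le
      have hε : ε ≤ γ'' := (add_le_add_iff_left γ').1 hβ
      have hε0 : ε ≠ 0 := by rintro rfl; simp at hβ'
      have hεlim : Order.IsSuccLimit ε := by
        refine ⟨not_isMin_iff_ne_bot.2 hε0, Order.isSuccPrelimit_iff_succ_ne.2 fun δ hδ ↦ ?_⟩
        exact Order.isSuccPrelimit_iff_succ_ne.1 hlim.isSuccPrelimit (γ' + δ) (by rw [hsucc, hδ])
      rw [hN2, Submodule.comap_coe, hl'' ε hε hεlim, Set.preimage_iUnion₂]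
      refine Set.Subset.antisymm (Set.iUnion₂_subset fun δ hδ ↦ ?_)
        (Set.iUnion₂_subset fun α hα ↦ ?_)
      · refine Set.subset_iUnion₂_of_subset (γ' + δ)
          ((add_lt_add_iff_left γ').2 hδ) ?_
        rw [hN2, Submodule.comap_coe]
      · rcases le_total α γ' with hα' | hα'
        -- Stages up to `γ'` lie in `ker p`, hence in every preimage; index `0` is available because
        -- the limit `ε` is nonzero.
        · refine Set.subset_iUnion₂_of_subset 0 (pos_iff_ne_zero.2 hε0) ?_
          rw [hN1 α hα']
          rintro _ ⟨x, -, rfl⟩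
          simp [hip.apply_apply_eq_zero]
        · obtain ⟨δ, rfl⟩ := exists_add_of_le hα'
          refine Set.subset_iUnion₂_of_subset δ ((add_lt_add_iff_left γ').1 hα) ?_
          rw [hN2, Submodule.comap_coe]
  · intro α hα
    rcases lt_or_ge α γ' with hα' | hα'
    · obtain ⟨k, hk⟩ := hs' α hα'
      refine ⟨k, ?_⟩
      rw [Submodule.nonempty_quotient_submoduleOf_equiv_iff] at hk ⊢
      obtain ⟨f, hf, hfk⟩ := hk
      rw [hN1 α hα'.le, hN1 _ (Order.succ_le_of_lt hα')]
      let e := Submodule.equivMapOfInjective i hi (N' (Order.succ α))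
      refine ⟨f ∘ₗ e.symm.toLinearMap, hf.comp e.symm.surjective, fun x ↦ ?_⟩
      obtain ⟨y, rfl⟩ := e.surjective x
      have : (e y : G) = i y := Submodule.coe_equivMapOfInjective_apply i hi _ y
      rw [this, LinearMap.comp_apply, LinearEquiv.coe_coe, e.symm_apply_apply, hfk]
      exact (Function.Injective.mem_set_image hi).symm
    · obtain ⟨δ, rfl⟩ := exists_add_of_le hα'
      obtain ⟨k, hk⟩ := hs'' δ ((add_lt_add_iff_left γ').1 hα)
      refine ⟨k, ?_⟩
      rw [Submodule.nonempty_quotient_submoduleOf_equiv_iff] at hk ⊢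
      obtain ⟨f, hf, hfk⟩ := hk
      rw [hsucc, hN2, hN2]
      let g : (N'' (Order.succ δ)).comap p →ₗ[R] N'' (Order.succ δ) :=
        p.restrict fun x hx ↦ hx
      have hg : Function.Surjective g := by
        rintro ⟨y, hy⟩
        obtain ⟨x, rfl⟩ := hp y
        exact ⟨⟨x, hy⟩, rfl⟩
      exact ⟨f ∘ₗ g, hf.comp hg, fun x ↦ hfk (g x)⟩

/-- Well-order `X` and let stage `α` consist of the functions supported on elements of rank below
`α`. The coordinate at the element of rank `α` identifies the next quotient with `M`. -/
theorem IsTransfiniteExtension.finsupp {κ : Type} (A : κ → ModuleCat.{u} R) (k : κ)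
    (M : Type u) [AddCommGroup M] [Module R M] (e : A k ≃ₗ[R] M) (X : Type u) :
    IsTransfiniteExtension A (X →₀ M) := by
  let r : X → X → Prop := WellOrderingRel
  let s : Ordinal.{u} → Set X := fun α ↦ {x | Ordinal.typein r x < α}
  have hmem (α : Ordinal.{u}) (x : X) : x ∈ s α ↔ Ordinal.typein r x < α := Iff.rfl
  refine ⟨Ordinal.type r, fun α ↦ Finsupp.supported M R (s α), ?_, ?_, ?_, ?_, ?_⟩
  · have : s 0 = ∅ := by ext; simp [s]
    simp only [this, Finsupp.supported_empty]
  · have : s (Ordinal.type r) = Set.univ := by ext; simp [s, Ordinal.typein_lt_type]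
    simp only [this, Finsupp.supported_univ]
  · intro α β hαβ _
    exact Finsupp.supported_mono fun x hx ↦ (hmem β x).2 (lt_of_lt_of_le hx hαβ)
  · intro β _ hβ
    refine Set.Subset.antisymm (fun f hf ↦ ?_) (Set.iUnion₂_subset fun α hα ↦
      Finsupp.supported_mono fun x hx ↦ (hmem β x).2 (lt_trans hx hα))
    -- The support is finite, so the supremum of the successors of its ranks stays below the limit
    -- `β`.
    refine Set.mem_iUnion₂.2 ⟨f.support.sup fun x ↦ Order.succ (Ordinal.typein r x), ?_, ?_⟩
    · refine (Finset.sup_lt_iff hβ.bot_lt).2 fun x hx ↦ hβ.succ_lt ?_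
      exact hf hx
    · intro x hx
      exact lt_of_lt_of_le (Order.lt_succ _)
        (Finset.le_sup (f := fun x ↦ Order.succ (Ordinal.typein r x)) hx)
  · intro α hα
    refine ⟨k, (Submodule.nonempty_quotient_submoduleOf_equiv_iff _ _).2 ?_⟩
    obtain ⟨x, rfl⟩ := Ordinal.typein_surj r hα
    refine ⟨e.symm.toLinearMap ∘ₗ Finsupp.lapply x ∘ₗ Submodule.subtype _, ?_, ?_⟩
    · intro a
      refine ⟨⟨Finsupp.single x (e a), Finsupp.single_mem_supported R _ ?_⟩, by simp⟩
      exact (hmem _ _).2 (Order.lt_succ _)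
    · rintro ⟨f, hf⟩
      simp only [LinearMap.comp_apply, LinearEquiv.coe_coe, Submodule.subtype_apply,
        Finsupp.lapply_apply, map_eq_zero_iff _ e.symm.injective]
      constructor
      · intro h y hy
        have hy' : Ordinal.typein r y ≤ Ordinal.typein r x := Order.lt_succ_iff.1 (hf hy)
        refine lt_of_le_of_ne hy' fun h' ↦ ?_
        rw [Ordinal.typein_inj] at h'
        subst h'
        exact Finsupp.mem_support_iff.1 hy h
      · intro h
        by_contra hx
        exact lt_irrefl _ ((hmem _ _).1 (h (Finsupp.mem_support_iff.2 hx)))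

end Filtrations

/-! ### Vanishing of `Ext` -/

section ExtVanishing

variable {R : Type u} [CommRing R]

theorem subsingleton_ext_of_exact {G' G G'' : Type u} [AddCommGroup G'] [Module R G']
    [AddCommGroup G] [Module R G] [AddCommGroup G''] [Module R G'']
    (i : G' →ₗ[R] G) (p : G →ₗ[R] G'')
    (hi : Function.Injective i) (hip : Function.Exact i p) (hp : Function.Surjective p)
    (C : ModuleCat.{u} R) (n : ℕ)
    (h' : Subsingleton (Abelian.Ext.{u} (ModuleCat.of R G') C n))
    (h'' : Subsingleton (Abelian.Ext.{u} (ModuleCat.of R G'') C n)) :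
    Subsingleton (Abelian.Ext.{u} (ModuleCat.of R G) C n) := by
  refine subsingleton_of_forall_eq 0 fun x ↦ ?_
  obtain ⟨y, rfl⟩ := Abelian.Ext.contravariant_sequence_exact₂
    (ModuleCat.shortExact_mk_of_exact hi hip hp) C x (h'.elim _ _)
  rw [h''.elim y 0, Abelian.Ext.comp_zero]

theorem subsingleton_ext_of_retract {C : Type*} [Category* C] [Abelian C] [HasExt.{u} C]
    {X Y : C} (h : Retract X Y) (Z : C) (n : ℕ)
    (hY : Subsingleton (Abelian.Ext.{u} Y Z n)) : Subsingleton (Abelian.Ext.{u} X Z n) := by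
  refine subsingleton_of_forall_eq 0 fun x ↦ ?_
  have : (Abelian.Ext.mk₀ h.i).comp ((Abelian.Ext.mk₀ h.r).comp x (zero_add n)) (zero_add n) = x := by
    simp
  rw [← this, hY.elim ((Abelian.Ext.mk₀ h.r).comp x (zero_add n)) 0, Abelian.Ext.comp_zero]

theorem subsingleton_ext_one_iff_of_projective {K L M : Type u} [AddCommGroup K] [Module R K]
    [AddCommGroup L] [Module R L] [Module.Projective R L] [AddCommGroup M] [Module R M]
    (i : K →ₗ[R] L) (p : L →ₗ[R] M)
    (hi : Function.Injective i) (hip : Function.Exact i p) (hp : Function.Surjective p)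
    (C : Type u) [AddCommGroup C] [Module R C] :
    Subsingleton (Abelian.Ext.{u} (ModuleCat.of R M) (ModuleCat.of R C) 1) ↔
      ∀ g : K →ₗ[R] C, ∃ h : L →ₗ[R] C, h ∘ₗ i = g := by
  have hS := ModuleCat.shortExact_mk_of_exact hi hip hp
  constructor
  · intro hM g
    obtain ⟨y, hy⟩ := Abelian.Ext.contravariant_sequence_exact₁ hS (ModuleCat.of R C)
      (Abelian.Ext.mk₀ (ModuleCat.ofHom g)) (add_zero 1) (hM.elim _ _)
    obtain ⟨h, rfl⟩ := (Abelian.Ext.mk₀_bijective _ _).2 y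
    rw [Abelian.Ext.mk₀_comp_mk₀] at hy
    have := (Abelian.Ext.mk₀_bijective _ _).1 hy
    exact ⟨h.hom, congrArg ModuleCat.Hom.hom this⟩
  · intro h
    refine subsingleton_of_forall_eq 0 fun x ↦ ?_
    obtain ⟨y, rfl⟩ := Abelian.Ext.contravariant_sequence_exact₃ hS (ModuleCat.of R C) x
      (Abelian.Ext.eq_zero_of_projective _) (add_zero 1)
    obtain ⟨g, rfl⟩ := (Abelian.Ext.mk₀_bijective _ _).2 y
    obtain ⟨h, hh⟩ := h g.hom
    have hg : g = ModuleCat.ofHom i ≫ ModuleCat.ofHom h := by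
      ext x
      exact (LinearMap.congr_fun hh x).symm
    rw [hg, ← Abelian.Ext.mk₀_comp_mk₀]
    exact hS.extClass_comp_assoc _

/-- For a direct sum of presentations, the extension problem is solved separately on each summand.
-/
theorem subsingleton_ext_one_finsupp (M X C : Type u) [AddCommGroup M] [Module R M]
    [AddCommGroup C] [Module R C]
    (h : Subsingleton (Abelian.Ext.{u} (ModuleCat.of R M) (ModuleCat.of R C) 1)) :
    Subsingleton (Abelian.Ext.{u} (ModuleCat.of R (X →₀ M)) (ModuleCat.of R C) 1) := by
  let p := Finsupp.linearCombination R (id : M → M)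
  let _ : AddCommGroup (LinearMap.ker p) := (LinearMap.ker p).addCommGroup
  have hp : Function.Surjective p := Finsupp.linearCombination_id_surjective R M
  have hip : Function.Exact (LinearMap.ker p).subtype p := LinearMap.exact_subtype_ker_map p
  have hi := (LinearMap.ker p).injective_subtype
  rw [subsingleton_ext_one_iff_of_projective (K := LinearMap.ker p) _ _ hi hip hp] at h
  rw [subsingleton_ext_one_iff_of_projective (K := X →₀ LinearMap.ker p) (L := X →₀ (M →₀ R)) _ _
    (Finsupp.mapRange_injective _ (map_zero _) hi)
    (Finsupp.mapRange_exact hi hip X)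
    (Finsupp.mapRange_surjective _ (map_zero _) hp)]
  intro g
  choose f hf using fun x ↦ h (g ∘ₗ Finsupp.lsingle x)
  refine ⟨Finsupp.lsum ℕ f, ?_⟩
  ext x y
  simpa using LinearMap.congr_fun (hf x) y

end ExtVanishing

/-! ### Decomposition of flat modules -/

section FlatModules

open TensorProduct

/-- A flat module extended to a principal ideal domain `A` with field of fractions `Q` becomes, up
to adding a free `A`-module, an extension of a `Q`-vector space by a free `A`-module. -/
theorem Module.Flat.exists_exact_finsupp_of_isPrincipalIdealRing {R A Q : Type u} [CommRing R]
    [CommRing A] [IsDomain A] [IsPrincipalIdealRing A] [CommRing Q] (hQ : IsField Q) [Algebra R A]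
    [Algebra R Q] [Algebra A Q] [IsScalarTower R A Q] (hAQ : Function.Injective (algebraMap A Q))
    (F : Type u) [AddCommGroup F] [Module R F] [Module.Flat R F] :
    ∃ (Z L Y : Type u) (k : (Z →₀ A) →ₗ[R] (A ⊗[R] F) × (L →₀ A))
      (π : (A ⊗[R] F) × (L →₀ A) →ₗ[R] (Y →₀ Q)),
      Function.Injective k ∧ Function.Exact k π ∧ Function.Surjective π := by
  let j : A ⊗[R] F →ₗ[A] Q ⊗[R] F := AlgebraTensorModule.rTensor R F (Algebra.linearMap A Q)
  have hj : Function.Injective j :=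
    Module.Flat.rTensor_preserves_injective_linearMap (M := F)
      ((Algebra.linearMap A Q).restrictScalars R) hAQ
  -- The cokernel of `j` is a module over the principal ideal domain `A`, so it has a free
  -- presentation over `A`; the pullback below lives over `A` as well.
  obtain ⟨Z, L, i, p, hi, hip, hp⟩ := exists_free_presentation (A := A)
    ((Q ⊗[R] F) ⧸ LinearMap.range j) (hasProjectiveDimensionLT_two_of_isPrincipalIdealRing _)
  obtain ⟨k, π, hk, hkπ, hπ⟩ := exists_pullback_equiv_prod j (LinearMap.range j).mkQ hj
    (LinearMap.exact_map_mkQ_range j) (Submodule.mkQ_surjective _) i p hi hip hp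
  have hfree : Module.Free Q (Q ⊗[R] F) := by
    let _ := hQ.toField
    infer_instance
  let e : (Q ⊗[R] F) ≃ₗ[R] (Module.Free.ChooseBasisIndex Q (Q ⊗[R] F) →₀ Q) :=
    (Module.Free.chooseBasis Q (Q ⊗[R] F)).repr.restrictScalars R
  refine ⟨Z, L, _, k.restrictScalars R, e.toLinearMap ∘ₗ π.restrictScalars R, hk, ?_,
    e.surjective.comp hπ⟩
  intro x
  rw [LinearMap.comp_apply, LinearEquiv.coe_coe, map_eq_zero_iff e e.injective]
  exact hkπ x

theorem Function.Exact.equiv_comp_rangeRestrict {R K K' L L' M : Type*} [CommRing R]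
    [AddCommGroup K] [Module R K] [AddCommGroup K'] [Module R K'] [AddCommGroup L] [Module R L]
    [AddCommGroup L'] [Module R L'] [AddCommGroup M] [Module R M] {f : K →ₗ[R] L} {g : L →ₗ[R] M}
    (h : Function.Exact f g) (a : K' ≃ₗ[R] K) (e : L ≃ₗ[R] L') :
    Function.Exact (e.toLinearMap ∘ₗ f ∘ₗ a.toLinearMap)
      (g.rangeRestrict ∘ₗ e.symm.toLinearMap) := by
  intro x
  obtain ⟨y, rfl⟩ := e.surjective x
  rw [LinearMap.comp_apply, LinearEquiv.coe_coe, e.symm_apply_apply, ← Subtype.coe_inj,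
    LinearMap.codRestrict_apply, Submodule.coe_zero, h y]
  constructor
  · rintro ⟨z, rfl⟩
    exact ⟨a.symm z, by simp⟩
  · rintro ⟨z, hz⟩
    exact ⟨_, e.injective hz⟩

theorem Module.hasProjectiveDimensionLT_tensorProduct_of_isField {R Q : Type u} [CommRing R]
    [CommRing Q] (hQ : IsField Q) [Algebra R Q] {n : ℕ}
    (hpdQ : ∀ Y : Type u, HasProjectiveDimensionLT (ModuleCat.of R (Y →₀ Q)) n)
    (F : Type u) [AddCommGroup F] [Module R F] :
    HasProjectiveDimensionLT (ModuleCat.of R (Q ⊗[R] F)) n := by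
  have hfree : Module.Free Q (Q ⊗[R] F) := by
    let _ := hQ.toField
    infer_instance
  let e : (Q ⊗[R] F) ≃ₗ[R] (Module.Free.ChooseBasisIndex Q (Q ⊗[R] F) →₀ Q) :=
    (Module.Free.chooseBasis Q (Q ⊗[R] F)).repr.restrictScalars R
  have := hpdQ (Module.Free.ChooseBasisIndex Q (Q ⊗[R] F))
  exact hasProjectiveDimensionLT_of_iso e.toModuleIso.symm n

/-- The abstract form of the argument: `hexact` says that `R` is the fibre product of `A₁` and `A₂`
over `Q`, and `Φ` is any property inherited by extensions. -/
theorem Module.Flat.exists_prod_of_isPrincipalIdealRing {R A₁ A₂ Q : Type u} [CommRing R]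
    [CommRing A₁] [IsDomain A₁] [IsPrincipalIdealRing A₁]
    [CommRing A₂] [IsDomain A₂] [IsPrincipalIdealRing A₂]
    [CommRing Q] (hQ : IsField Q) [Algebra R A₁] [Algebra R A₂] [Algebra R Q]
    [Algebra A₁ Q] [IsScalarTower R A₁ Q] [Algebra A₂ Q] [IsScalarTower R A₂ Q]
    (h₁ : Function.Injective (algebraMap A₁ Q)) (h₂ : Function.Injective (algebraMap A₂ Q))
    (hR : Function.Injective (algebraMap R A₁))
    (hexact : ∀ (x : A₁) (y : A₂), algebraMap A₁ Q x = algebraMap A₂ Q y →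
      ∃ r : R, algebraMap R A₁ r = x ∧ algebraMap R A₂ r = y)
    (hpdR : ∀ (N : Type u) [AddCommGroup N] [Module R N],
      HasProjectiveDimensionLT (ModuleCat.of R N) 3)
    (hpdQ : ∀ Y : Type u, HasProjectiveDimensionLT (ModuleCat.of R (Y →₀ Q)) 2)
    (Φ : ∀ (G : Type u) [AddCommGroup G] [Module R G], Prop)
    (hΦ : ∀ {G' G G'' : Type u} [AddCommGroup G'] [Module R G'] [AddCommGroup G] [Module R G]
      [AddCommGroup G''] [Module R G''] (i : G' →ₗ[R] G) (p : G →ₗ[R] G''),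
      Function.Injective i → Function.Exact i p → Function.Surjective p → Φ G' → Φ G'' → Φ G)
    (hΦR : ∀ X : Type u, Φ (X →₀ R)) (hΦ₁ : ∀ X : Type u, Φ (X →₀ A₁))
    (hΦ₂ : ∀ X : Type u, Φ (X →₀ A₂)) (hΦQ : ∀ X : Type u, Φ (X →₀ Q))
    (F : Type u) [AddCommGroup F] [Module R F] [Module.Flat R F] :
    ∃ (F' : Type u) (_ : AddCommGroup F') (_ : Module R F'), Φ (F × F') := by
  obtain ⟨Z₁, L₁, Y₁, k₁, π₁, hk₁, hkπ₁, hπ₁⟩ :=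
    Module.Flat.exists_exact_finsupp_of_isPrincipalIdealRing (R := R) hQ h₁ F
  obtain ⟨Z₂, L₂, Y₂, k₂, π₂, hk₂, hkπ₂, hπ₂⟩ :=
    Module.Flat.exists_exact_finsupp_of_isPrincipalIdealRing (R := R) hQ h₂ F
  let δ : R →ₗ[R] A₁ × A₂ := (Algebra.linearMap R A₁).prod (Algebra.linearMap R A₂)
  let ψ : A₁ × A₂ →ₗ[R] Q := LinearMap.coprod (IsScalarTower.toAlgHom R A₁ Q).toLinearMap
    (-(IsScalarTower.toAlgHom R A₂ Q).toLinearMap)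
  have hδ : Function.Injective δ := fun x y hxy ↦ hR (congrArg Prod.fst hxy)
  have hδψ : Function.Exact δ ψ := by
    rintro ⟨x, y⟩
    constructor
    · intro h
      obtain ⟨r, hx, hy⟩ := hexact x y (by simpa [ψ, ← sub_eq_add_neg, sub_eq_zero] using h)
      exact ⟨r, Prod.ext hx hy⟩
    · rintro ⟨r, hr⟩
      rw [← hr]
      simp [ψ, δ]
  let e := TensorProduct.prodLeft R R A₁ A₂ F
  let j : F →ₗ[R] (A₁ ⊗[R] F) × (A₂ ⊗[R] F) :=
    e.toLinearMap ∘ₗ δ.rTensor F ∘ₗ (TensorProduct.lid R F).symm.toLinearMap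
  let ψF := ψ.rTensor F
  let q : (A₁ ⊗[R] F) × (A₂ ⊗[R] F) →ₗ[R] LinearMap.range ψF :=
    ψF.rangeRestrict ∘ₗ e.symm.toLinearMap
  have hj : Function.Injective j := e.injective.comp
    ((Module.Flat.rTensor_preserves_injective_linearMap δ hδ).comp (TensorProduct.lid R F).symm.injective)
  have hjq : Function.Exact j q :=
    (Module.Flat.rTensor_exact F hδψ).equiv_comp_rangeRestrict (TensorProduct.lid R F).symm e
  have hq : Function.Surjective q := ψF.surjective_rangeRestrict.comp e.symm.surjective
  -- The quotient of `Q ⊗ F` by the image has dimension at most two and `Q ⊗ F` at most one, so the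
  -- image, a first syzygy relative to `Q ⊗ F`, has at most one.
  have hE : HasProjectiveDimensionLT (ModuleCat.of R (LinearMap.range ψF)) 2 := by
    have := Module.hasProjectiveDimensionLT_tensorProduct_of_isField hQ hpdQ F
    have hS := ModuleCat.shortExact_mk_of_exact (K := LinearMap.range ψF)
      (LinearMap.range ψF).injective_subtype (LinearMap.exact_subtype_mkQ (LinearMap.range ψF))
      (Submodule.mkQ_surjective _)
    exact hS.hasProjectiveDimensionLT_X₁ 2 this (hpdR _)
  obtain ⟨Z, L, i, p, hi, hip, hp⟩ := exists_free_presentation (A := R) (LinearMap.range ψF) hE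
  obtain ⟨k, π, hk, hkπ, hπ⟩ := exists_pullback_equiv_prod (T := LinearMap.range ψF)
    j q hj hjq hq i p hi hip hp
  have hprod {G H : Type u} [AddCommGroup G] [Module R G] [AddCommGroup H] [Module R H] (hG : Φ G)
      (hH : Φ H) : Φ (G × H) :=
    hΦ (LinearMap.inl R G H) (LinearMap.snd R G H) LinearMap.inl_injective Function.Exact.inl_snd
      Prod.snd_surjective hG hH
  have hW := hprod (hΦ k₁ π₁ hk₁ hkπ₁ hπ₁ (hΦ₁ _) (hΦQ _)) (hΦ k₂ π₂ hk₂ hkπ₂ hπ₂ (hΦ₂ _) (hΦQ _))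
  let M := (L₁ →₀ A₁) × (L₂ →₀ A₂)
  let e₁ := LinearEquiv.prodProdProdComm R (A₁ ⊗[R] F) (A₂ ⊗[R] F) (L₁ →₀ A₁) (L₂ →₀ A₂)
  let e₂ := LinearEquiv.prodAssoc R F (L →₀ R) M
  -- Only after adding `M` is `(A₁ ⊗ F) × (A₂ ⊗ F)` known to satisfy `Φ`, so `M` is added to the
  -- middle and right terms of the pullback sequence.
  refine ⟨(L →₀ R) × M, inferInstance, inferInstance,
    hΦ (e₂.toLinearMap ∘ₗ LinearMap.inl R _ M ∘ₗ k)
      (e₁.toLinearMap ∘ₗ π.prodMap LinearMap.id ∘ₗ e₂.symm.toLinearMap)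
      ?_ ?_ ?_ (hΦR Z) hW⟩
  · exact e₂.injective.comp (LinearMap.inl_injective.comp hk)
  · intro x
    obtain ⟨⟨y, m⟩, rfl⟩ := e₂.surjective x
    simp only [LinearMap.comp_apply, LinearEquiv.coe_coe, e₂.symm_apply_apply,
      map_eq_zero_iff e₁ e₁.injective, LinearMap.prodMap_apply, Prod.mk_eq_zero, LinearMap.id_apply]
    constructor
    · rintro ⟨hy, rfl⟩
      obtain ⟨z, rfl⟩ := (hkπ y).1 hy
      exact ⟨z, rfl⟩
    · rintro ⟨z, hz⟩
      have := e₂.injective hz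
      exact ⟨(hkπ y).2 ⟨z, congrArg Prod.fst this⟩, (congrArg Prod.snd this).symm⟩
  · exact e₁.surjective.comp ((hπ.prodMap Function.surjective_id).comp e₂.symm.surjective)

end FlatModules

/-! ### The two localizations of `P[x]` -/

section LocalizedPolynomials

variable (P : Type u) [CommRing P] [IsDomain P]

/-- Inverting the nonzero constants gives `K[x]` over the fraction field `K` of `P`. -/
theorem isPrincipalIdealRing_localization_nonzeroConstants :
    IsPrincipalIdealRing (Localization (nonzeroConstants P)) := by
  have hS : nonzeroConstants P = (nonZeroDivisors P).map (C : P →+* P[X]) := by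
    ext f
    simp [nonzeroConstants, eq_comm]
  let K := FractionRing P
  let _ : Algebra P[X] K[X] := (mapRingHom (algebraMap P K)).toAlgebra
  have : IsLocalization (nonzeroConstants P) K[X] := by
    rw [hS]
    exact Polynomial.isLocalization (nonZeroDivisors P) K
  exact IsPrincipalIdealRing.of_surjective
    (IsLocalization.algEquiv (nonzeroConstants P) K[X] (Localization (nonzeroConstants P))).toRingHom
    (AlgEquiv.surjective _)

variable [IsPrincipalIdealRing P]

theorem Polynomial.exists_eq_C_mul_of_ne_zero {f : P[X]} (hf : f ≠ 0) :
    ∃ a : P, a ≠ 0 ∧ ∃ g ∈ contentOne P, f = C a * g := by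
  let _ : StrongNormalizationMonoid P := UniqueFactorizationMonoid.strongNormalizationMonoid
  let _ : NormalizedGCDMonoid P := UniqueFactorizationMonoid.toNormalizedGCDMonoid P
  exact ⟨f.content, content_eq_zero_iff.not.2 hf, f.primPart,
    (hasContentOne_iff_isPrimitive _).2 f.isPrimitive_primPart, f.eq_C_content_mul_primPart⟩

/-- Gauss's lemma: content is multiplicative up to units, so `f * g` and `f` have associated
contents. -/
theorem Polynomial.C_dvd_of_dvd_mul_contentOne {a : P} {f g : P[X]} (hg : g ∈ contentOne P)
    (h : C a ∣ f * g) : C a ∣ f := by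
  let _ : StrongNormalizationMonoid P := UniqueFactorizationMonoid.strongNormalizationMonoid
  let _ : NormalizedGCDMonoid P := UniqueFactorizationMonoid.toNormalizedGCDMonoid P
  have hg' : g.IsPrimitive := (hasContentOne_iff_isPrimitive _).1 hg
  rw [← dvd_content_iff_C_dvd] at h ⊢
  rwa [(associated_content_mul f g).dvd_iff_dvd_right, hg'.content_eq_one, mul_one] at h

theorem contentOne_le_nonZeroDivisors : contentOne P ≤ nonZeroDivisors P[X] := by
  intro f hf
  exact mem_nonZeroDivisors_of_ne_zero ((hasContentOne_iff_isPrimitive _).1 hf).ne_zero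

theorem nonzeroConstants_le_nonZeroDivisors {P : Type u} [CommRing P] [IsDomain P] :
    nonzeroConstants P ≤ nonZeroDivisors P[X] := by
  rintro _ ⟨a, ha, rfl⟩
  exact mem_nonZeroDivisors_of_ne_zero (C_ne_zero.2 ha)

theorem nonzeroConstants_sup_contentOne :
    nonzeroConstants P ⊔ contentOne P = nonZeroDivisors P[X] := by
  refine le_antisymm (sup_le nonzeroConstants_le_nonZeroDivisors
    (contentOne_le_nonZeroDivisors P)) fun f hf ↦ ?_
  obtain ⟨a, ha, g, hg, rfl⟩ := exists_eq_C_mul_of_ne_zero P (nonZeroDivisors.ne_zero hf)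
  exact Submonoid.mul_mem_sup ⟨a, ha, rfl⟩ hg

/-- A nonzero polynomial is a constant times a polynomial of content one, which becomes a unit. So
every ideal is generated by the constants in it, that is, extended from an ideal of `P`. -/
theorem isPrincipalIdealRing_localization_contentOne :
    IsPrincipalIdealRing (Localization (contentOne P)) := by
  let φ : P →+* Localization (contentOne P) :=
    (algebraMap P[X] (Localization (contentOne P))).comp C
  refine ⟨fun I ↦ ?_⟩
  have hI : I = (I.comap φ).map φ := by
    refine le_antisymm (fun x hx ↦ ?_) Ideal.map_comap_le
    obtain ⟨⟨f, s⟩, hfs⟩ := IsLocalization.surj (contentOne P) x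
    have hs := IsLocalization.map_units (Localization (contentOne P)) s
    have hx' := I.mul_mem_right (algebraMap _ _ (s : P[X])) hx
    rw [← Ideal.mul_unit_mem_iff_mem _ hs]
    rw [hfs] at hx' ⊢
    rcases eq_or_ne f 0 with rfl | hf
    · simp
    obtain ⟨a, ha, g, hg, rfl⟩ := exists_eq_C_mul_of_ne_zero P hf
    have hg := IsLocalization.map_units (Localization (contentOne P)) (⟨g, hg⟩ : contentOne P)
    rw [map_mul, Ideal.mul_unit_mem_iff_mem _ hg] at hx' ⊢
    exact Ideal.mem_map_of_mem φ hx'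
  obtain ⟨g, hg⟩ := (IsPrincipalIdealRing.principal (I.comap φ)).principal
  rw [hI, hg]
  refine ⟨φ g, ?_⟩
  rw [← Ideal.span, ← Ideal.span, Ideal.map_span, Set.image_singleton]

/-- If `f / a = g / t` with `a` constant and `t` of content one, then `a` divides `f * t`, hence
`f`; the quotient is the required polynomial. -/
theorem exists_algebraMap_eq_of_localization {Q : Type u} [CommRing Q] [Algebra P[X] Q]
    [IsFractionRing P[X] Q]
    [Algebra (Localization (nonzeroConstants P)) Q] [Algebra (Localization (contentOne P)) Q]
    [IsScalarTower P[X] (Localization (nonzeroConstants P)) Q]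
    [IsScalarTower P[X] (Localization (contentOne P)) Q]
    (x : Localization (nonzeroConstants P)) (y : Localization (contentOne P))
    (h : algebraMap _ Q x = algebraMap _ Q y) : ∃ r : P[X], algebraMap _ _ r = x ∧
      algebraMap _ _ r = y := by
  obtain ⟨f, s, rfl⟩ := IsLocalization.exists_mk'_eq (nonzeroConstants P) x
  obtain ⟨g, t, rfl⟩ := IsLocalization.exists_mk'_eq (contentOne P) y
  obtain ⟨a, ha, hs⟩ := s.2
  have key : f * t = g * s := by
    apply IsFractionRing.injective P[X] Q
    have h1 := congrArg (algebraMap _ Q) (IsLocalization.mk'_spec (Localization (nonzeroConstants P)) f s)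
    have h2 := congrArg (algebraMap _ Q) (IsLocalization.mk'_spec (Localization (contentOne P)) g t)
    rw [map_mul, ← IsScalarTower.algebraMap_apply, ← IsScalarTower.algebraMap_apply] at h1 h2
    rw [map_mul, map_mul, ← h1, ← h2, h]
    ring
  have ha' : (C a : P[X]) ≠ 0 := C_ne_zero.2 ha
  obtain ⟨r, rfl⟩ := Polynomial.C_dvd_of_dvd_mul_contentOne P t.2
    (Dvd.intro_left g (by rw [← hs]; exact key.symm))
  rw [hs, mul_assoc, mul_comm g] at key
  have hg := mul_left_cancel₀ ha' key
  refine ⟨r, ?_, ?_⟩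
  · rw [eq_comm, IsLocalization.mk'_eq_iff_eq_mul, hs, ← map_mul, mul_comm]
  · rw [eq_comm, IsLocalization.mk'_eq_iff_eq_mul, ← map_mul, hg]

end LocalizedPolynomials

/-! ### Assembly over `P[x]` -/

theorem IsLocalization.injective_algebraMap_of_isScalarTower {R A Q : Type*} [CommRing R]
    [CommRing A] [CommRing Q] [Algebra R A] [Algebra R Q] [Algebra A Q] [IsScalarTower R A Q]
    (S : Submonoid R) [IsLocalization S A] (h : Function.Injective (algebraMap R Q)) :
    Function.Injective (algebraMap A Q) := by
  rw [injective_iff_map_eq_zero]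
  intro x hx
  obtain ⟨⟨f, s⟩, hfs⟩ := IsLocalization.surj S x
  have hf : algebraMap R Q f = 0 := by
    rw [IsScalarTower.algebraMap_apply R A Q, ← hfs, map_mul, hx, zero_mul]
  obtain rfl : f = 0 := h (by rw [hf, map_zero])
  rw [map_zero] at hfs
  exact (IsLocalization.map_units A s).mul_left_eq_zero.1 hfs

/-- Every flat `P[X]`-module is a direct summand of an iterated extension of direct sums of copies
of the four localizations of `P[X]`. -/
theorem Polynomial.exists_prod_of_flat (P : Type u) [CommRing P] [IsDomain P]
    [IsPrincipalIdealRing P] [Countable P]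
    (Φ : ∀ (G : Type u) [AddCommGroup G] [Module P[X] G], Prop)
    (hΦ : ∀ {G' G G'' : Type u} [AddCommGroup G'] [Module P[X] G'] [AddCommGroup G]
      [Module P[X] G] [AddCommGroup G''] [Module P[X] G''] (i : G' →ₗ[P[X]] G)
      (p : G →ₗ[P[X]] G''),
      Function.Injective i → Function.Exact i p → Function.Surjective p → Φ G' → Φ G'' → Φ G)
    (hΦR : ∀ X : Type u, Φ (X →₀ P[X]))
    (hΦ₁ : ∀ X : Type u, Φ (X →₀ Localization (nonzeroConstants P)))
    (hΦ₂ : ∀ X : Type u, Φ (X →₀ Localization (contentOne P)))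
    (hΦQ : ∀ X : Type u, Φ (X →₀ Localization (nonzeroConstants P ⊔ contentOne P)))
    (F : Type u) [AddCommGroup F] [Module P[X] F] [Module.Flat P[X] F] :
    ∃ (F' : Type u) (_ : AddCommGroup F') (_ : Module P[X] F'), Φ (F × F') := by
  let A₁ := Localization (nonzeroConstants P)
  let A₂ := Localization (contentOne P)
  let Q := Localization (nonzeroConstants P ⊔ contentOne P)
  have : IsDomain A₁ := IsLocalization.isDomain_localization nonzeroConstants_le_nonZeroDivisors
  have : IsDomain A₂ := IsLocalization.isDomain_localization (contentOne_le_nonZeroDivisors P)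
  have : IsPrincipalIdealRing A₁ := isPrincipalIdealRing_localization_nonzeroConstants P
  have : IsPrincipalIdealRing A₂ := isPrincipalIdealRing_localization_contentOne P
  have : IsFractionRing P[X] Q := by
    have h (S : Submonoid P[X]) (hS : nonzeroConstants P ⊔ contentOne P = S) :
        IsLocalization S Q := by
      subst hS
      exact Localization.isLocalization
    exact h _ (nonzeroConstants_sup_contentOne P)
  have hQ : IsField Q := by
    let _ := IsFractionRing.toField P[X] (K := Q)
    exact Field.toIsField Q
  have hle₁ : nonzeroConstants P ≤ nonzeroConstants P ⊔ contentOne P := le_sup_left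
  have hle₂ : contentOne P ≤ nonzeroConstants P ⊔ contentOne P := le_sup_right
  let _ : Algebra A₁ Q := IsLocalization.localizationAlgebraOfSubmonoidLe A₁ Q _ _ hle₁
  let _ : Algebra A₂ Q := IsLocalization.localizationAlgebraOfSubmonoidLe A₂ Q _ _ hle₂
  have : IsScalarTower P[X] A₁ Q :=
    IsLocalization.localization_isScalarTower_of_submonoid_le A₁ Q _ _ hle₁
  have : IsScalarTower P[X] A₂ Q :=
    IsLocalization.localization_isScalarTower_of_submonoid_le A₂ Q _ _ hle₂
  have hRQ := IsFractionRing.injective P[X] Q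
  -- Countability of `P` serves to resolve `Q` by free modules in length one.
  have : Countable P[X] := (Polynomial.basisMonomials P).repr.injective.countable
  obtain ⟨φ, p, hφ, hφp, hp⟩ := IsFractionRing.exists_free_resolution P[X] Q
  exact Module.Flat.exists_prod_of_isPrincipalIdealRing hQ
    (IsLocalization.injective_algebraMap_of_isScalarTower (nonzeroConstants P) hRQ)
    (IsLocalization.injective_algebraMap_of_isScalarTower (contentOne P) hRQ)
    (IsLocalization.injective A₁ nonzeroConstants_le_nonZeroDivisors)
    (fun x y h ↦ exists_algebraMap_eq_of_localization P x y h)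
    (fun N _ _ ↦ Polynomial.hasProjectiveDimensionLT_three P N)
    (fun Y ↦ Finsupp.hasProjectiveDimensionLT_two_of_exact Y φ p hφ hφp hp)
    Φ hΦ hΦR hΦ₁ hΦ₂ hΦQ F

theorem mainTheorem11 (P : Type u) [CommRing P] [IsDomain P] [IsPrincipalIdealRing P]
    [Countable P] (F : Type u) [AddCommGroup F] [Module P[X] F] [Module.Flat P[X] F] :
    IsStronglyFlat (multClosure ![nonzeroConstants P, contentOne P]) F ∧
      IsSummandOfTransfiniteExtension
        ![ModuleCat.of P[X] P[X],
          ModuleCat.of P[X] (Localization (nonzeroConstants P)),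
          ModuleCat.of P[X] (Localization (contentOne P)),
          ModuleCat.of P[X] (Localization (nonzeroConstants P ⊔ contentOne P))] F := by
  constructor
  · intro C _ _ hC
    have h₁ := hC {0}
    have h₂ := hC {1}
    have h₁₂ := hC {0, 1}
    have e₁ : multClosure ![nonzeroConstants P, contentOne P] {0} = nonzeroConstants P := by
      simp [multClosure]
    have e₂ : multClosure ![nonzeroConstants P, contentOne P] {1} = contentOne P := by
      simp [multClosure]
    have e₁₂ : multClosure ![nonzeroConstants P, contentOne P] {0, 1} =
        nonzeroConstants P ⊔ contentOne P := by
      rw [multClosure, iSup_insert, iSup_singleton]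
      rfl
    rw [e₁] at h₁
    rw [e₂] at h₂
    rw [e₁₂] at h₁₂
    -- Take `Φ` to be the vanishing of `Ext¹(-, C)`; it then passes to the summand `F`.
    obtain ⟨F', _, _, h⟩ := Polynomial.exists_prod_of_flat P
      (fun G _ _ ↦ Subsingleton
        (Abelian.Ext.{u} (ModuleCat.of P[X] G) (ModuleCat.of P[X] C) 1))
      (fun i p hi hip hp ↦ subsingleton_ext_of_exact i p hi hip hp _ 1)
      (fun X ↦ subsingleton_of_forall_eq 0 Abelian.Ext.eq_zero_of_projective)
      (fun X ↦ subsingleton_ext_one_finsupp _ X C h₁)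
      (fun X ↦ subsingleton_ext_one_finsupp _ X C h₂)
      (fun X ↦ subsingleton_ext_one_finsupp _ X C h₁₂) F
    exact subsingleton_ext_of_retract
      { i := ModuleCat.ofHom (LinearMap.inl P[X] F F'), r := ModuleCat.ofHom (LinearMap.fst P[X] F F') }
      _ 1 h
  · obtain ⟨F', _, _, h⟩ := Polynomial.exists_prod_of_flat P
      (fun G _ _ ↦ IsTransfiniteExtension
        ![ModuleCat.of P[X] P[X],
          ModuleCat.of P[X] (Localization (nonzeroConstants P)),
          ModuleCat.of P[X] (Localization (contentOne P)),
          ModuleCat.of P[X] (Localization (nonzeroConstants P ⊔ contentOne P))] G)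
      (fun i p hi hip hp ↦ IsTransfiniteExtension.of_exact i p hi hip hp)
      (IsTransfiniteExtension.finsupp _ 0 _ (LinearEquiv.refl _ _))
      (IsTransfiniteExtension.finsupp _ 1 _ (LinearEquiv.refl _ _))
      (IsTransfiniteExtension.finsupp _ 2 _ (LinearEquiv.refl _ _))
      (IsTransfiniteExtension.finsupp _ 3 _ (LinearEquiv.refl _ _)) F
    exact ⟨F × F', inferInstance, inferInstance, F', inferInstance, inferInstance, h,
      ⟨LinearEquiv.refl _ _⟩⟩
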